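/- Let $\alpha>-1$ be real with $\alpha\ne 0,1,2,\dots$, let $n\in\{0,1,2,\dots\}$ and $\xi<0$. Let $$L_n^\alpha(\eta)=\sum_{k=0}^n\binom{n+\alpha}{n-k}\frac{(-1)^k\eta^k}{k!},\qquad \binom{a}{m}=\frac{\Gamma(a+1)}{m!\,\Gamma(a-m+1)},$$ be the Laguerre polynomial, let $$\Phi(a,c;x)=\sum_{k=0}^\infty\frac{(a)_k\,x^k}{(c)_k\,k!}\quad(c\neq 0,-1,-2,\dots),\qquad (a)_k=a(a+1)\cdots(a+k-1),$$ be the confluent hypergeometric function, and let $$\Psi(a,c;x)=\frac1{\Gamma(a)}\int_0^\infty e^{-xt}\,t^{a-1}(1+t)^{c-a-1}\,dt\quad(a>0,\ x>0)$$ be the Tricomi function. Then the integral $\int_0^\infty \frac{\eta^\alpha e^{-\eta}L_n^\alpha(\eta)}{\eta-\xi}\,d\eta$ converges absolutely, and $$\int_0^\infty\frac{\eta^\alpha e^{-\eta}L_n^\alpha(\eta)\,d\eta}{\eta-\xi}=\Gamma(\alpha)\,\Phi(n+1,1-\alpha;-\xi)+\frac{\Gamma(-\alpha)\Gamma(n+\alpha+1)}{n!}\,(-\xi)^\alpha\,\Phi(n+1+\alpha,1+\alpha;-\xi).$$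 Equivalently, the same integral equals $\Gamma(n+\alpha+1)\,\Psi(n+1,1-\alpha;-\xi)$. -/

import Mathlib

open MeasureTheory Set

/-- The binomial coefficient `a` over `n` for real `a`, through the Gamma function. -/
noncomputable def realBinom (a : ℝ) (n : ℕ) : ℝ :=
  Real.Gamma (a + 1) / ((n.factorial : ℝ) * Real.Gamma (a - (n : ℝ) + 1))

/-- The (generalized) Laguerre polynomial `L_n^α`, for `α > -1`. -/
noncomputable def laguerreL (n : ℕ) (α x : ℝ) : ℝ :=
  ∑ k ∈ Finset.range (n + 1),
    realBinom ((n : ℝ) + α) (n - k) * ((-1) ^ k * x ^ k / (k.factorial : ℝ))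

/-- The general term of the confluent hypergeometric series; `(ascPochhammer ℝ k).eval a` is the
factorial symbol `a (a + 1) ⋯ (a + k - 1)`. -/
noncomputable def kummerTerm (a c x : ℝ) (k : ℕ) : ℝ :=
  (ascPochhammer ℝ k).eval a * x ^ k / ((ascPochhammer ℝ k).eval c * (k.factorial : ℝ))

/-- The confluent hypergeometric function `Φ(a, c; x)`, for `c ≠ 0, -1, -2, …`
(the series converges for all such `c` and all `a`, `x`: see `summable_kummerTerm`). -/
noncomputable def kummerPhi (a c x : ℝ) : ℝ :=
  ∑' k : ℕ, kummerTerm a c x k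

/-- The Tricomi function `Ψ(a, c; x)` for `a > 0`, `x > 0`, by its standard integral formula
(the integral converges for all such `a`, `x` and all `c`: see `integrableOn_tricomi`). -/
noncomputable def tricomiPsi (a c x : ℝ) : ℝ :=
  1 / Real.Gamma a *
    ∫ t in Ioi (0 : ℝ), Real.exp (-x * t) * t ^ (a - 1) * (1 + t) ^ (c - a - 1)

theorem summable_kummerTerm (a c x : ℝ) (hc : ∀ k : ℕ, c ≠ -(k : ℝ)) :
    Summable (kummerTerm a c x) := by
  have hstep : ∀ k : ℕ, kummerTerm a c x (k + 1)
      = ((a + k) * x / ((c + k) * (k + 1))) * kummerTerm a c x k := by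
    intro k
    have h1 : c + k ≠ 0 := fun h => hc k (by linarith)
    have h2 : (ascPochhammer ℝ k).eval c ≠ 0 := by
      rw [Ne, ascPochhammer_eval_eq_zero_iff]
      rintro ⟨j, -, hj⟩
      exact hc j (by linarith)
    have h3 : (k.factorial : ℝ) ≠ 0 := by positivity
    have h4 : (k : ℝ) + 1 ≠ 0 := by positivity
    simp only [kummerTerm, ascPochhammer_succ_eval, Nat.factorial_succ]
    push_cast
    field_simp
    ring
  have hlim : Filter.Tendsto (fun k : ℕ => ‖(a + k) * x / ((c + k) * (k + 1))‖) Filter.atTop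
      (nhds 0) := by
    have e1 : Filter.Tendsto (fun k : ℕ => (a + 1 * (k : ℝ)) / (c + 1 * k)) Filter.atTop
        (nhds (1 / 1)) := tendsto_add_mul_div_add_mul_atTop_nhds a c 1 one_ne_zero
    have e2 : Filter.Tendsto (fun k : ℕ => x * (1 / ((k : ℝ) + 1))) Filter.atTop
        (nhds (x * 0)) := tendsto_one_div_add_atTop_nhds_zero_nat.const_mul x
    have := (e1.mul e2).norm
    simp only [mul_zero, norm_zero] at this
    refine this.congr fun k => ?_
    congr 1
    rw [one_mul, mul_one_div, div_mul_div_comm]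
  refine summable_of_ratio_norm_eventually_le (r := 1 / 2) (by norm_num) ?_
  filter_upwards [hlim.eventually_lt_const (show (0 : ℝ) < 1 / 2 by norm_num)] with k hk
  rw [hstep, norm_mul]
  gcongr

theorem integrableOn_tricomi (a c x : ℝ) (ha : 0 < a) (hx : 0 < x) :
    IntegrableOn (fun t : ℝ => Real.exp (-x * t) * t ^ (a - 1) * (1 + t) ^ (c - a - 1))
      (Ioi 0) := by
  obtain ⟨m, hm⟩ := exists_nat_ge (c - a - 1)
  set C : ℝ := Real.exp (x / 2) * ((m.factorial : ℝ) / (x / 2) ^ m) with hC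
  have hx2 : 0 < x / 2 := by linarith
  have hg : IntegrableOn (fun t : ℝ => C * (t ^ (a - 1) * Real.exp (-(x / 2) * t))) (Ioi 0) := by
    have := integrableOn_rpow_mul_exp_neg_mul_rpow (s := a - 1) (p := 1) (b := x / 2)
      (by linarith) one_pos hx2
    simp only [Real.rpow_one] at this
    exact this.const_mul C
  refine Integrable.mono' hg ?_ ?_
  · exact Measurable.aestronglyMeasurable (by fun_prop)
  · refine (ae_restrict_iff' measurableSet_Ioi).2 (Filter.Eventually.of_forall fun t ht => ?_)
    have ht : 0 < t := ht
    have h1 : (1 + t) ^ (c - a - 1) ≤ (1 + t) ^ m := by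
      rw [← Real.rpow_natCast]
      exact Real.rpow_le_rpow_of_exponent_le (by linarith) hm
    have h2 : (1 + t) ^ m ≤ C * Real.exp (x / 2 * t) := by
      have := Real.pow_div_factorial_le_exp (x / 2 * (1 + t)) (by positivity) m
      rw [div_le_iff₀ (by positivity), mul_pow] at this
      have e : Real.exp (x / 2 * (1 + t)) = Real.exp (x / 2) * Real.exp (x / 2 * t) := by
        rw [← Real.exp_add]; ring_nf
      rw [e] at this
      have hp : 0 < (x / 2) ^ m := by positivity
      calc (1 + t) ^ m = ((x / 2) ^ m * (1 + t) ^ m) / (x / 2) ^ m := by field_simp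
        _ ≤ (Real.exp (x / 2) * Real.exp (x / 2 * t) * m.factorial) / (x / 2) ^ m := by gcongr
        _ = _ := by rw [hC]; ring
    rw [Real.norm_of_nonneg (by positivity)]
    calc Real.exp (-x * t) * t ^ (a - 1) * (1 + t) ^ (c - a - 1)
        ≤ Real.exp (-x * t) * t ^ (a - 1) * (C * Real.exp (x / 2 * t)) := by
          gcongr; exact h1.trans h2
      _ = C * (t ^ (a - 1) * (Real.exp (-x * t) * Real.exp (x / 2 * t))) := by ring
      _ = C * (t ^ (a - 1) * Real.exp (-(x / 2) * t)) := by
          rw [← Real.exp_add]; ring_nf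

/-! Put `x = -ξ > 0`. Writing `1/(η + x)` as the Laplace integral `∫ exp(-(η + x)t) dt` and
integrating over `η` first turns the Stieltjes transform of `η^β e^{-η}` into `Γ(β+1) Ψ(1, 1-β; x)`
(`integral_rpow_mul_exp_neg_div_add`). In the expansion of `L_n^α` the factor `Γ(α+k+1)` cancels
against the coefficient of `η^k`, leaving a constant times `(-1)^k C(n,k)`. Under the Tricomi
integrals the binomial theorem then sums `(1+t)^{-k}` to `(t/(1+t))^n`, which gives `Γ(n+α+1) Ψ(n+1,
1-α; x)` (`integral_laguerre_div_add`).

It remains to express `Ψ` through the two Kummer solutions (`tricomiPsi_eq_kummerSide`), by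
induction on `n`. Differentiation in `x` takes the pair `(n, α+1)` to `(n+1, α)` on both sides with
the same factor `-(n+1)`, so the identity for `n` at `α+1` implies the one for `n+1` at `α`. For `n
= 0` and `-1 < α < 0` the identity is the splitting of `Γ(-α)` at `x` into two incomplete gamma
integrals. Larger `α` are reached by a first-order recurrence in `α` which both sides satisfy. -/

/-! ### Kummer series: derivative, contiguous relation, special parameters -/

theorem ascPochhammer_eval_succ_left (a : ℝ) (k : ℕ) :
    (ascPochhammer ℝ (k + 1)).eval a = a * (ascPochhammer ℝ k).eval (a + 1) := by
  simp [ascPochhammer_succ_left, Polynomial.eval_comp]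

theorem ascPochhammer_eval_ne_zero {c : ℝ} (hc : ∀ k : ℕ, c ≠ -(k : ℝ)) (k : ℕ) :
    (ascPochhammer ℝ k).eval c ≠ 0 := by
  rw [Ne, ascPochhammer_eval_eq_zero_iff]
  rintro ⟨j, -, hj⟩
  exact hc j (by linarith)

theorem add_one_ne_neg_natCast {c : ℝ} (hc : ∀ k : ℕ, c ≠ -(k : ℝ)) (k : ℕ) :
    c + 1 ≠ -(k : ℝ) := fun h => hc (k + 1) (by push_cast; linarith)

theorem kummerTerm_zero (a c x : ℝ) : kummerTerm a c x 0 = 1 := by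
  simp [kummerTerm]

theorem succ_mul_kummerTerm_succ (a x : ℝ) {c : ℝ} (hc : ∀ k : ℕ, c ≠ -(k : ℝ)) (k : ℕ) :
    ((k : ℝ) + 1) * kummerTerm a c x (k + 1) = x * (a / c) * kummerTerm (a + 1) (c + 1) x k := by
  have h0 : c ≠ 0 := by simpa using hc 0
  have h2 := ascPochhammer_eval_ne_zero (add_one_ne_neg_natCast hc) k
  have h3 : (k.factorial : ℝ) ≠ 0 := by positivity
  have h4 : (k : ℝ) + 1 ≠ 0 := by positivity
  simp only [kummerTerm, ascPochhammer_eval_succ_left, Nat.factorial_succ, pow_succ]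
  push_cast
  field_simp

theorem hasDerivAt_kummerTerm_succ (a x : ℝ) {c : ℝ} (hc : ∀ k : ℕ, c ≠ -(k : ℝ)) (k : ℕ) :
    HasDerivAt (fun y => kummerTerm a c y (k + 1)) (a / c * kummerTerm (a + 1) (c + 1) x k) x := by
  have h0 : c ≠ 0 := by simpa using hc 0
  have h2 := ascPochhammer_eval_ne_zero (add_one_ne_neg_natCast hc) k
  have h3 : (k.factorial : ℝ) ≠ 0 := by positivity
  have h4 : (k : ℝ) + 1 ≠ 0 := by positivity
  have h := ((hasDerivAt_pow (k + 1) x).const_mul ((ascPochhammer ℝ (k + 1)).eval a)).div_const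
    ((ascPochhammer ℝ (k + 1)).eval c * ((k + 1).factorial : ℝ))
  refine h.congr_deriv ?_
  simp only [kummerTerm, ascPochhammer_eval_succ_left, Nat.factorial_succ, Nat.add_sub_cancel]
  push_cast
  field_simp

theorem kummerPhi_eq_one_add (a x : ℝ) {c : ℝ} (hc : ∀ k : ℕ, c ≠ -(k : ℝ)) :
    kummerPhi a c x = 1 + ∑' k : ℕ, kummerTerm a c x (k + 1) := by
  rw [kummerPhi, (summable_kummerTerm a c x hc).tsum_eq_zero_add, kummerTerm_zero]

/-- Termwise differentiation after splitting off the constant term, so that the `k`-th derivative is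
a multiple of the `k`-th term of the shifted series. On the ball of radius `R = |x| + 1` the
derivatives are dominated by their absolute values at `R`. -/
theorem hasDerivAt_kummerPhi (a x : ℝ) {c : ℝ} (hc : ∀ k : ℕ, c ≠ -(k : ℝ)) :
    HasDerivAt (kummerPhi a c) (a / c * kummerPhi (a + 1) (c + 1) x) x := by
  have hc1 := add_one_ne_neg_natCast hc
  set R : ℝ := |x| + 1 with hR
  have hsum : Summable fun k => ‖a / c * kummerTerm (a + 1) (c + 1) R k‖ :=
    ((summable_kummerTerm (a + 1) (c + 1) R hc1).mul_left (a / c)).norm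
  have h := hasDerivAt_tsum_of_isPreconnected (g := fun k y => kummerTerm a c y (k + 1))
    (g' := fun k y => a / c * kummerTerm (a + 1) (c + 1) y k) (y₀ := x) (y := x)
    hsum Metric.isOpen_ball (convex_ball (0 : ℝ) R).isPreconnected
    (fun k y _ => hasDerivAt_kummerTerm_succ a y hc k)
    (fun k y hy => ?_) (by simp [hR])
    ((summable_nat_add_iff 1).2 (summable_kummerTerm a c x hc)) (by simp [hR])
  · rw [tsum_mul_left] at h
    exact (h.const_add 1).congr_of_eventuallyEq
      (Filter.Eventually.of_forall fun y => kummerPhi_eq_one_add a y hc)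
  · have hy' : |y| ≤ |R| := by
      rw [abs_of_pos (show 0 < R by positivity)]
      simpa using (mem_ball_zero_iff.1 hy).le
    simp only [kummerTerm, norm_mul, norm_div, norm_pow, Real.norm_eq_abs]
    gcongr

/-- Since `(c)_k (c + k) = c (c+1)_k`, applying `c + x d/dx` to `Φ(a, c+1; x)` multiplies its `k`-th
term by `c + k` and produces `c Φ(a, c; x)`. -/
theorem kummerPhi_contiguous (a x : ℝ) {c : ℝ} (hc : ∀ k : ℕ, c ≠ -(k : ℝ)) :
    c * kummerPhi a c x =
      c * kummerPhi a (c + 1) x + x * (a / (c + 1) * kummerPhi (a + 1) (c + 1 + 1) x) := by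
  have hc1 := add_one_ne_neg_natCast hc
  rw [kummerPhi_eq_one_add a x hc, kummerPhi_eq_one_add a x hc1, mul_add, mul_add, add_assoc]
  congr 1
  rw [kummerPhi, ← tsum_mul_left, ← tsum_mul_left, ← tsum_mul_left, ← tsum_mul_left,
    ← Summable.tsum_add
      (((summable_nat_add_iff 1).2 (summable_kummerTerm a (c + 1) x hc1)).mul_left c)
      (((summable_kummerTerm (a + 1) (c + 1 + 1) x (add_one_ne_neg_natCast hc1)).mul_left
        _).mul_left x)]
  refine tsum_congr fun k => ?_
  rw [← mul_assoc, ← succ_mul_kummerTerm_succ a x hc1 k]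
  have h0 : c ≠ 0 := by simpa using hc 0
  have h2 := ascPochhammer_eval_ne_zero hc1 k
  have h3 := ascPochhammer_eval_ne_zero hc1 (k + 1)
  have h5 : c + 1 + k ≠ 0 := fun h => hc (k + 1) (by push_cast; linarith)
  have h6 : (((k + 1).factorial : ℕ) : ℝ) ≠ 0 := by positivity
  simp only [kummerTerm, ascPochhammer_eval_succ_left c, ascPochhammer_succ_eval k (c + 1)]
  field_simp
  ring

theorem hasDerivAt_rpow_mul_kummerPhi (a : ℝ) {x c : ℝ} (hx : 0 < x)
    (hc : ∀ k : ℕ, c ≠ -(k : ℝ)) :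
    HasDerivAt (fun y => y ^ c * kummerPhi a (c + 1) y) (c * x ^ (c - 1) * kummerPhi a c x) x := by
  have h := (Real.hasDerivAt_rpow_const (p := c) (Or.inl hx.ne')).mul
    (hasDerivAt_kummerPhi a x (add_one_ne_neg_natCast hc))
  refine h.congr_deriv ?_
  have e : x ^ c = x ^ (c - 1) * x := by
    rw [← Real.rpow_add_one hx.ne', sub_add_cancel]
  rw [e]
  linear_combination -x ^ (c - 1) * kummerPhi_contiguous a x hc

theorem kummerPhi_self (x : ℝ) {c : ℝ} (hc : ∀ k : ℕ, c ≠ -(k : ℝ)) :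
    kummerPhi c c x = Real.exp x := by
  rw [kummerPhi, Real.exp_eq_exp_ℝ, NormedSpace.exp_eq_tsum_div]
  refine tsum_congr fun k => ?_
  have := ascPochhammer_eval_ne_zero hc k
  rw [kummerTerm]
  field_simp

theorem kummerPhi_one_left (x : ℝ) {c : ℝ} (hc : ∀ k : ℕ, c ≠ -(k : ℝ)) :
    kummerPhi 1 c x = 1 + x / c * kummerPhi 1 (c + 1) x := by
  rw [kummerPhi_eq_one_add 1 x hc, kummerPhi, ← tsum_mul_left]
  congr 1
  refine tsum_congr fun k => ?_
  have h0 : c ≠ 0 := by simpa using hc 0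
  have h2 := ascPochhammer_eval_ne_zero (add_one_ne_neg_natCast hc) k
  simp only [kummerTerm, ascPochhammer_eval_succ_left c, ascPochhammer_eval_one, pow_succ]
  field_simp

/-! ### Incomplete gamma integrals and the Tricomi function -/

/-- The right-hand side is an antiderivative: its derivative is `y^(a-1) e^{-y} (Φ(1, a; y) - (y/a)
Φ(1, a+1; y))`, and the bracket is `1` by `kummerPhi_one_left`. -/
theorem integral_rpow_mul_exp_neg_zero_to {a x : ℝ} (ha : 0 < a) (hx : 0 < x) :
    ∫ s in (0 : ℝ)..x, s ^ (a - 1) * Real.exp (-s) =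
      x ^ a * Real.exp (-x) * kummerPhi 1 (a + 1) x / a := by
  have hc : ∀ k : ℕ, a ≠ -(k : ℝ) := fun k h => by
    have : (0 : ℝ) ≤ k := k.cast_nonneg
    linarith
  have hcont : Continuous (kummerPhi 1 (a + 1)) := continuous_iff_continuousAt.2 fun y =>
    (hasDerivAt_kummerPhi 1 y (add_one_ne_neg_natCast hc)).continuousAt
  rw [intervalIntegral.integral_eq_sub_of_hasDerivAt_of_le hx.le
    (f := fun y => y ^ a * kummerPhi 1 (a + 1) y * Real.exp (-y) / a)]
  · simp only [Real.zero_rpow ha.ne']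
    ring
  · exact ((((Real.continuous_rpow_const ha.le).mul hcont).mul
      (by fun_prop)).div_const a).continuousOn
  · intro y hy
    have hd := ((hasDerivAt_rpow_mul_kummerPhi 1 hy.1 hc).mul
      ((hasDerivAt_neg y).exp)).div_const a
    refine hd.congr_deriv ?_
    have e : y ^ a = y ^ (a - 1) * y := by
      rw [← Real.rpow_add_one hy.1.ne', sub_add_cancel]
    rw [e, kummerPhi_one_left y hc]
    field_simp
    ring
  · exact (intervalIntegral.intervalIntegrable_rpow' (by linarith)).mul_continuousOn
      (by fun_prop)

theorem hasDerivAt_tricomiPsi {a c x : ℝ} (ha : 0 < a) (hx : 0 < x) :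
    HasDerivAt (tricomiPsi a c) (-a * tricomiPsi (a + 1) (c + 1) x) x := by
  -- For `y > x/2` the differentiated integrand is dominated by its value at `x/2`, itself a Tricomi
  -- integrand.
  have hint := integrableOn_tricomi (a + 1) (c + 1) (x / 2) (by linarith) (by linarith)
  have h := (hasDerivAt_integral_of_dominated_loc_of_deriv_le
    (μ := volume.restrict (Ioi (0 : ℝ)))
    (F := fun y t : ℝ => Real.exp (-y * t) * t ^ (a - 1) * (1 + t) ^ (c - a - 1))
    (F' := fun y t : ℝ => -(Real.exp (-y * t) * t ^ (a + 1 - 1) * (1 + t) ^ (c + 1 - (a + 1) - 1)))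
    (Ioi_mem_nhds (show x / 2 < x by linarith))
    (Filter.Eventually.of_forall fun y => Measurable.aestronglyMeasurable (by fun_prop))
    (integrableOn_tricomi a c x ha hx) (Measurable.aestronglyMeasurable (by fun_prop))
    ((ae_restrict_iff' measurableSet_Ioi).2 (Filter.Eventually.of_forall fun t ht y hy => ?_))
    hint
    ((ae_restrict_iff' measurableSet_Ioi).2
      (Filter.Eventually.of_forall fun t ht y hy => ?_))).2
  · have h2 := h.const_mul (1 / Real.Gamma a)
    refine h2.congr_deriv ?_
    have := (Real.Gamma_pos_of_pos ha).ne'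
    rw [integral_neg, tricomiPsi, Real.Gamma_add_one ha.ne']
    field_simp
  · have ht : 0 < t := ht
    have hy : x / 2 < y := hy
    rw [norm_neg, Real.norm_of_nonneg (by positivity)]
    gcongr
  · have ht : 0 < t := ht
    have e : t ^ (a + 1 - 1) = t ^ (a - 1) * t := by
      rw [← Real.rpow_add_one ht.ne']; ring_nf
    have hd := ((((hasDerivAt_neg y).mul_const t).exp).mul_const (t ^ (a - 1))).mul_const
      ((1 + t) ^ (c - a - 1))
    refine hd.congr_deriv ?_
    rw [e, show c + 1 - (a + 1) - 1 = c - a - 1 by ring]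
    ring

/-- Substitute `s = x(1 + t)`, done as a translation followed by a scaling. -/
theorem integral_rpow_mul_exp_neg_Ioi_eq_tricomiPsi (a : ℝ) {x : ℝ} (hx : 0 < x) :
    ∫ s in Ioi x, s ^ (a - 1) * Real.exp (-s) =
      x ^ a * Real.exp (-x) * tricomiPsi 1 (1 + a) x := by
  have h1 := (measurePreserving_add_left (volume : Measure ℝ) x).setIntegral_preimage_emb
    (measurableEmbedding_addLeft x) (fun s => s ^ (a - 1) * Real.exp (-s)) (Ioi x)
  have h2 := integral_comp_mul_left_Ioi
    (fun s => (x + s) ^ (a - 1) * Real.exp (-(x + s))) 0 hx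
  have hpre : (fun s : ℝ => x + s) ⁻¹' Ioi x = Ioi 0 := by
    ext s
    simp
  rw [hpre] at h1
  rw [mul_zero, h1, smul_eq_mul, eq_inv_mul_iff_mul_eq₀ hx.ne'] at h2
  rw [← h2, tricomiPsi, Real.Gamma_one, div_one, one_mul, ← integral_const_mul,
    ← integral_const_mul]
  refine setIntegral_congr_fun measurableSet_Ioi fun t ht => ?_
  have ht : 0 < t := ht
  have e1 : x ^ a = x ^ (a - 1) * x := by
    rw [← Real.rpow_add_one hx.ne', sub_add_cancel]
  have e2 : x + x * t = x * (1 + t) := by ring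
  have e3 : Real.exp (-(x + x * t)) = Real.exp (-x) * Real.exp (-x * t) := by
    rw [← Real.exp_add]
    ring_nf
  simp only [e3]
  rw [e2, e1, Real.mul_rpow hx.le (by positivity), sub_self, Real.rpow_zero,
    show 1 + a - 1 - 1 = a - 1 by ring]
  ring

/-! ### Stieltjes transform of the gamma density -/

theorem integrableOn_rpow_mul_exp_neg {β : ℝ} (hβ : -1 < β) :
    IntegrableOn (fun η : ℝ => η ^ β * Real.exp (-η)) (Ioi 0) := by
  simpa [mul_comm] using Real.GammaIntegral_convergent (s := β + 1) (by linarith)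

theorem integral_rpow_mul_exp_neg {β : ℝ} (hβ : -1 < β) :
    ∫ η in Ioi (0 : ℝ), η ^ β * Real.exp (-η) = Real.Gamma (β + 1) := by
  rw [Real.Gamma_eq_integral (by linarith), add_sub_cancel_right]
  simp only [mul_comm]

theorem integrableOn_rpow_mul_exp_neg_div_add {β x : ℝ} (hβ : -1 < β) (hx : 0 < x) :
    IntegrableOn (fun η : ℝ => η ^ β * Real.exp (-η) / (η + x)) (Ioi 0) := by
  refine Integrable.mono' ((integrableOn_rpow_mul_exp_neg hβ).div_const x)
    (Measurable.aestronglyMeasurable (by fun_prop))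
    ((ae_restrict_iff' measurableSet_Ioi).2 (Filter.Eventually.of_forall fun η hη => ?_))
  have hη : 0 < η := hη
  rw [Real.norm_of_nonneg (by positivity)]
  gcongr
  linarith

theorem integral_rpow_mul_exp_neg_div_add {β x : ℝ} (hβ : -1 < β) (hx : 0 < x) :
    ∫ η in Ioi (0 : ℝ), η ^ β * Real.exp (-η) / (η + x) =
      Real.Gamma (β + 1) * tricomiPsi 1 (1 - β) x := by
  set F : ℝ → ℝ → ℝ := fun η t => η ^ β * Real.exp (-η) * Real.exp (-(η + x) * t) with hF
  have hinner : ∀ η ∈ Ioi (0 : ℝ),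
      ∫ t in Ioi (0 : ℝ), F η t = η ^ β * Real.exp (-η) / (η + x) := by
    intro η hη
    have hη : 0 < η := hη
    have h0 : η + x ≠ 0 := by positivity
    simp only [hF]
    rw [integral_const_mul, integral_exp_mul_Ioi (by linarith), mul_zero, Real.exp_zero]
    field_simp
  -- `F` is nonnegative on the quadrant, so the integral of its norm over `t` is the quotient in
  -- `hinner`, already known to be integrable in `η`.
  have hFint : Integrable (Function.uncurry F)
      ((volume.restrict (Ioi (0 : ℝ))).prod (volume.restrict (Ioi (0 : ℝ)))) := by
    rw [integrable_prod_iff (Measurable.aestronglyMeasurable (by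
      simp only [hF, Function.uncurry_def]; fun_prop))]
    constructor
    · refine (ae_restrict_iff' measurableSet_Ioi).2 (Filter.Eventually.of_forall fun η hη => ?_)
      have hη : 0 < η := hη
      exact (integrableOn_exp_mul_Ioi (show -(η + x) < 0 by linarith) 0).const_mul
        (η ^ β * Real.exp (-η))
    · refine (integrableOn_rpow_mul_exp_neg_div_add hβ hx).congr
        ((ae_restrict_iff' measurableSet_Ioi).2 (Filter.Eventually.of_forall fun η hη => ?_))
      simp only [Function.uncurry_apply_pair]
      rw [← hinner η hη]
      have hη : 0 < η := hη
      refine integral_congr_ae (Filter.Eventually.of_forall fun t => ?_)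
      exact (Real.norm_of_nonneg (by positivity)).symm
  rw [← setIntegral_congr_fun measurableSet_Ioi hinner, integral_integral_swap hFint, tricomiPsi,
    Real.Gamma_one, div_one, one_mul, ← integral_const_mul]
  refine setIntegral_congr_fun measurableSet_Ioi fun t ht => ?_
  have ht : 0 < t := ht
  have h := Real.integral_rpow_mul_exp_neg_mul_Ioi (a := β + 1) (r := 1 + t) (by linarith)
    (by positivity)
  rw [add_sub_cancel_right] at h
  have e : ∀ η : ℝ, F η t = Real.exp (-x * t) * (η ^ β * Real.exp (-((1 + t) * η))) := by
    intro η
    simp only [hF]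
    rw [mul_assoc, ← Real.exp_add, mul_left_comm, ← Real.exp_add]
    ring_nf
  simp only [e]
  rw [integral_const_mul, h, sub_self, Real.rpow_zero, one_div, Real.inv_rpow (by positivity),
    ← Real.rpow_neg (by positivity), show 1 - β - 1 - 1 = -(β + 1) by ring]
  ring

/-- Read through the Stieltjes transform, this is `η/(η + x) = 1 - x/(η + x)` integrated against
`η^β e^{-η}`. -/
theorem tricomiPsi_one_add_one {β x : ℝ} (hβ : -1 < β) (hx : 0 < x) :
    Real.Gamma (β + 1 + 1) * tricomiPsi 1 (1 - (β + 1)) x =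
      Real.Gamma (β + 1) - x * (Real.Gamma (β + 1) * tricomiPsi 1 (1 - β) x) := by
  rw [← integral_rpow_mul_exp_neg_div_add (by linarith) hx,
    ← integral_rpow_mul_exp_neg_div_add hβ hx, ← integral_rpow_mul_exp_neg hβ,
    ← integral_const_mul, ← integral_sub (integrableOn_rpow_mul_exp_neg hβ)
      ((integrableOn_rpow_mul_exp_neg_div_add hβ hx).const_mul x)]
  refine setIntegral_congr_fun measurableSet_Ioi fun η hη => ?_
  have hη : 0 < η := hη
  simp only [Real.rpow_add_one hη.ne']
  field_simp
  ring

/-! ### Tricomi function as a combination of Kummer solutions -/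

/-- The combination of the two Kummer solutions that represents
`Γ(n + α + 1) Ψ(n + 1, 1 - α; x)`. -/
noncomputable def kummerSide (n : ℕ) (α x : ℝ) : ℝ :=
  Real.Gamma α * kummerPhi ((n : ℝ) + 1) (1 - α) x +
    Real.Gamma (-α) * Real.Gamma ((n : ℝ) + α + 1) / (n.factorial : ℝ) *
      x ^ α * kummerPhi ((n : ℝ) + 1 + α) (1 + α) x

theorem ne_neg_natCast_of_pos {c : ℝ} (hc : 0 < c) (k : ℕ) : c ≠ -(k : ℝ) := by
  have : (0 : ℝ) ≤ k := k.cast_nonneg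
  intro h
  linarith

/-- With `a = -α > 0`, split `Γ(a)` at `x`: the lower part is a Kummer function and the upper part
is `Ψ(1, 1+a; x)` up to elementary factors. Solving for `Ψ` and using `Γ(1-a) = -a Γ(-a)` gives the
claim, the exponential being `Φ(1+α, 1+α; x)`. -/
theorem tricomiPsi_one_eq_kummerSide_of_neg {α x : ℝ} (hα : -1 < α) (hα0 : α < 0) (hx : 0 < x) :
    Real.Gamma (α + 1) * tricomiPsi 1 (1 - α) x = kummerSide 0 α x := by
  obtain ⟨a, rfl⟩ : ∃ a, α = -a := ⟨-α, by ring⟩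
  have ha : 0 < a := by linarith
  have h1 := intervalIntegral.integral_interval_add_Ioi
    (integrableOn_rpow_mul_exp_neg (β := a - 1) (by linarith))
    ((integrableOn_rpow_mul_exp_neg (β := a - 1) (by linarith)).mono_set
      (Ioi_subset_Ioi hx.le))
  rw [integral_rpow_mul_exp_neg_zero_to ha hx, integral_rpow_mul_exp_neg_Ioi_eq_tricomiPsi a hx,
    integral_rpow_mul_exp_neg (by linarith), sub_add_cancel] at h1
  have hG := Real.Gamma_add_one (s := -a) (by linarith)
  have hpow : x ^ a * x ^ (-a) = 1 := by rw [← Real.rpow_add hx]; simp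
  have hexp : Real.exp x * Real.exp (-x) = 1 := by rw [← Real.exp_add]; simp
  have hΦ := kummerPhi_self x (c := 1 + -a) (ne_neg_natCast_of_pos (by linarith))
  have hE : tricomiPsi 1 (1 + a) x =
      x ^ (-a) * Real.exp x * Real.Gamma a - kummerPhi 1 (a + 1) x / a := by
    rw [← h1]
    linear_combination (-(tricomiPsi 1 (1 + a) x) - kummerPhi 1 (a + 1) x / a) *
      (Real.exp x * Real.exp (-x) * hpow + hexp)
  simp only [kummerSide, Nat.cast_zero, zero_add, Nat.factorial_zero, Nat.cast_one, div_one, hΦ,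
    neg_neg, sub_neg_eq_add, hE]
  rw [add_comm a 1, hG]
  field_simp
  ring

/-- The counterpart of `tricomiPsi_one_add_one`. The inhomogeneous term is the leading `1` of `Φ(1,
-α; x)`; in the other solution both Kummer functions are `e^x`, and only the gamma factors and the
power of `x` change. -/
theorem kummerSide_zero_add_one {α x : ℝ} (hα : -1 < α) (hα' : ∀ k : ℕ, α ≠ (k : ℝ)) (hx : 0 < x) :
    kummerSide 0 (α + 1) x = Real.Gamma (α + 1) - x * kummerSide 0 α x := by
  have h0 : α ≠ 0 := by simpa using hα' 0
  have hΦ := kummerPhi_self x (c := 1 + α) (ne_neg_natCast_of_pos (by linarith))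
  have hΦ' := kummerPhi_self x (c := 1 + (α + 1)) (ne_neg_natCast_of_pos (by linarith))
  have h1 := kummerPhi_one_left x (c := -α) fun k h => hα' k (by linarith)
  have hG := Real.Gamma_add_one h0
  have hG1 := Real.Gamma_add_one (s := α + 1) (by linarith)
  have hG' := Real.Gamma_add_one (s := -(α + 1)) (by linarith)
  rw [show -(α + 1) + 1 = -α by ring] at hG'
  simp only [kummerSide, Nat.cast_zero, zero_add, Nat.factorial_zero, Nat.cast_one, div_one, hΦ,
    hΦ', hG1, hG', hG, Real.rpow_add_one hx.ne', show 1 - (α + 1) = -α by ring, h1,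
    show -α + 1 = 1 - α by ring]
  field_simp
  ring

theorem tricomiPsi_one_eq_kummerSide {α x : ℝ} (hα : -1 < α) (hα' : ∀ k : ℕ, α ≠ (k : ℝ))
    (hx : 0 < x) : Real.Gamma (α + 1) * tricomiPsi 1 (1 - α) x = kummerSide 0 α x := by
  -- Induction on an integer bound for `α`: each step lowers `α` by one until it falls in `(-1, 0)`.
  obtain ⟨m, hm⟩ := exists_nat_gt α
  induction m generalizing α with
  | zero => exact tricomiPsi_one_eq_kummerSide_of_neg hα (by simpa using hm) hx
  | succ m ih =>
    rcases lt_or_gt_of_ne (show α ≠ 0 by simpa using hα' 0) with h | h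
    · exact tricomiPsi_one_eq_kummerSide_of_neg hα h hx
    · obtain ⟨β, rfl⟩ : ∃ β, α = β + 1 := ⟨α - 1, by ring⟩
      have hβ : -1 < β := by linarith
      have hβ' : ∀ k : ℕ, β ≠ (k : ℝ) := fun k hk => hα' (k + 1) (by push_cast; linarith)
      rw [tricomiPsi_one_add_one hβ hx, kummerSide_zero_add_one hβ hβ' hx,
        ih hβ hβ' (by push_cast at hm; linarith)]

/-- Mirrors `hasDerivAt_tricomiPsi` at `a = n+1`, `c = -α`. The first solution has the plain Kummer
derivative, and the second, carrying the factor `x^(α+1)`, is handled by the contiguous relation. -/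
theorem hasDerivAt_kummerSide (n : ℕ) {α x : ℝ} (hα : -1 < α) (hα' : ∀ k : ℕ, α ≠ (k : ℝ))
    (hx : 0 < x) :
    HasDerivAt (kummerSide n (α + 1)) (-((n : ℝ) + 1) * kummerSide (n + 1) α x) x := by
  have h0 : α ≠ 0 := by simpa using hα' 0
  have h1 := hasDerivAt_kummerPhi ((n : ℝ) + 1) x (c := 1 - (α + 1))
    fun k h => hα' k (by linarith)
  have h2 := hasDerivAt_rpow_mul_kummerPhi ((n : ℝ) + 1 + (α + 1)) hx (c := α + 1)
    (ne_neg_natCast_of_pos (by linarith))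
  have hd := (h1.const_mul (Real.Gamma (α + 1))).add (h2.const_mul
    (Real.Gamma (-(α + 1)) * Real.Gamma ((n : ℝ) + (α + 1) + 1) / (n.factorial : ℝ)))
  refine (hd.congr_of_eventuallyEq (Filter.Eventually.of_forall fun y => ?_)).congr_deriv ?_
  · simp only [kummerSide, add_comm 1 (α + 1), mul_assoc, Pi.add_apply]
  have hG := Real.Gamma_add_one h0
  have hG' := Real.Gamma_add_one (s := -(α + 1)) (by linarith)
  rw [show -(α + 1) + 1 = -α by ring] at hG'
  have hf : (n.factorial : ℝ) ≠ 0 := by positivity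
  simp only [kummerSide, Nat.factorial_succ, hG, hG', Nat.cast_add, Nat.cast_one, Nat.cast_mul,
    show 1 - (α + 1) = -α by ring, show -α + 1 = 1 - α by ring, add_sub_cancel_right,
    show (n : ℝ) + 1 + (α + 1) = n + 1 + 1 + α by ring,
    show (n : ℝ) + (α + 1) + 1 = n + 1 + α + 1 by ring, add_comm 1 α]
  field_simp
  ring

theorem tricomiPsi_eq_kummerSide (n : ℕ) {α x : ℝ} (hα : -1 < α) (hα' : ∀ k : ℕ, α ≠ (k : ℝ))
    (hx : 0 < x) :
    Real.Gamma ((n : ℝ) + α + 1) * tricomiPsi ((n : ℝ) + 1) (1 - α) x = kummerSide n α x := by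
  induction n generalizing α x with
  | zero => simpa using tricomiPsi_one_eq_kummerSide hα hα' hx
  | succ n ih =>
    have hβ : -1 < α + 1 := by linarith
    -- The value `α + 1 = 0` is not covered by `hα'`; it is excluded by `α > -1`.
    have hβ' : ∀ k : ℕ, α + 1 ≠ (k : ℝ) := by
      rintro (_ | k) hk
      · push_cast at hk
        linarith
      · exact hα' k (by push_cast at hk; linarith)
    have h1 := (hasDerivAt_tricomiPsi (a := (n : ℝ) + 1) (c := 1 - (α + 1)) (by positivity)
      hx).const_mul (Real.Gamma ((n : ℝ) + (α + 1) + 1))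
    -- The induction hypothesis at `α + 1` holds for all `y` near `x`, so both derivatives belong to
    -- the same function and agree by uniqueness.
    have h2 := (hasDerivAt_kummerSide n hα hα' hx).congr_of_eventuallyEq
      ((eventually_gt_nhds hx).mono fun y hy => ih hβ hβ' hy)
    have h := h1.unique h2
    rw [show 1 - (α + 1) + 1 = 1 - α by ring,
      show (n : ℝ) + (α + 1) + 1 = n + 1 + α + 1 by ring] at h
    have hn : -((n : ℝ) + 1) ≠ 0 := by
      have : (0 : ℝ) < (n : ℝ) + 1 := by positivity
      linarith
    push_cast
    refine mul_left_cancel₀ hn ?_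
    linear_combination h

/-! ### Laguerre expansion and the binomial sum -/

/-- The coefficient of the monomial of degree `k` in `laguerreL n α`. -/
noncomputable def laguerreCoeff (n : ℕ) (α : ℝ) (k : ℕ) : ℝ :=
  realBinom ((n : ℝ) + α) (n - k) * ((-1) ^ k / (k.factorial : ℝ))

/-- The denominator of the generalized binomial contains exactly `Γ(α + k + 1)`, so only an ordinary
alternating binomial coefficient still depends on `k`. -/
theorem laguerreCoeff_mul_Gamma {n k : ℕ} (hk : k ≤ n) {α : ℝ} (hα : -1 < α) :
    laguerreCoeff n α k * Real.Gamma (α + k + 1) =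
      Real.Gamma ((n : ℝ) + α + 1) / (n.factorial : ℝ) * ((-1) ^ k * (n.choose k : ℝ)) := by
  have hk0 : (0 : ℝ) ≤ k := k.cast_nonneg
  have hG : Real.Gamma (α + k + 1) ≠ 0 := (Real.Gamma_pos_of_pos (by linarith)).ne'
  rw [laguerreCoeff, realBinom, Nat.cast_sub hk,
    show (n : ℝ) + α - (n - k) + 1 = α + k + 1 by ring, Nat.cast_choose ℝ hk]
  have h1 : (n.factorial : ℝ) ≠ 0 := by positivity
  have h2 : (k.factorial : ℝ) ≠ 0 := by positivity
  have h3 : ((n - k).factorial : ℝ) ≠ 0 := by positivity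
  field_simp

theorem laguerre_integrand_eq_sum (n : ℕ) (α x : ℝ) {η : ℝ} (hη : 0 < η) :
    η ^ α * Real.exp (-η) * laguerreL n α η / (η + x) =
      ∑ k ∈ Finset.range (n + 1),
        laguerreCoeff n α k * (η ^ (α + k) * Real.exp (-η) / (η + x)) := by
  rw [laguerreL, Finset.mul_sum, Finset.sum_div]
  refine Finset.sum_congr rfl fun k _ => ?_
  rw [Real.rpow_add hη, Real.rpow_natCast, laguerreCoeff]
  ring

theorem integrableOn_laguerre_div_add (n : ℕ) {α x : ℝ} (hα : -1 < α) (hx : 0 < x) :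
    IntegrableOn (fun η : ℝ => η ^ α * Real.exp (-η) * laguerreL n α η / (η + x)) (Ioi 0) := by
  refine IntegrableOn.congr_fun (integrable_finsetSum _ fun k _ => ?_)
    (fun η hη => (laguerre_integrand_eq_sum n α x hη).symm) measurableSet_Ioi
  have hk0 : (0 : ℝ) ≤ k := k.cast_nonneg
  exact (integrableOn_rpow_mul_exp_neg_div_add (by linarith) hx).const_mul _

theorem integral_laguerre_div_add (n : ℕ) {α x : ℝ} (hα : -1 < α) (hx : 0 < x) :
    ∫ η in Ioi (0 : ℝ), η ^ α * Real.exp (-η) * laguerreL n α η / (η + x) =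
      Real.Gamma ((n : ℝ) + α + 1) * tricomiPsi ((n : ℝ) + 1) (1 - α) x := by
  have hαk : ∀ k : ℕ, -1 < α + k := fun k => by
    have hk0 : (0 : ℝ) ≤ k := k.cast_nonneg
    linarith
  rw [setIntegral_congr_fun measurableSet_Ioi
      (fun η hη => laguerre_integrand_eq_sum n α x hη),
    integral_finsetSum _ fun k _ =>
      (integrableOn_rpow_mul_exp_neg_div_add (hαk k) hx).const_mul _]
  have hterm : ∀ k ∈ Finset.range (n + 1),
      ∫ η in Ioi (0 : ℝ), laguerreCoeff n α k * (η ^ (α + k) * Real.exp (-η) / (η + x)) =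
        ∫ t in Ioi (0 : ℝ), Real.Gamma ((n : ℝ) + α + 1) / (n.factorial : ℝ) *
          ((-1) ^ k * (n.choose k : ℝ)) *
            (Real.exp (-x * t) * t ^ ((1 : ℝ) - 1) * (1 + t) ^ (1 - (α + k) - 1 - 1)) := by
    intro k hk
    rw [integral_const_mul, integral_rpow_mul_exp_neg_div_add (hαk k) hx, integral_const_mul,
      ← laguerreCoeff_mul_Gamma (Finset.mem_range_succ_iff.1 hk) hα, tricomiPsi, Real.Gamma_one]
    ring
  rw [Finset.sum_congr rfl hterm, ← integral_finsetSum (Finset.range (n + 1)) fun k _ =>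
    (integrableOn_tricomi 1 (1 - (α + k)) x one_pos hx).const_mul
      (Real.Gamma ((n : ℝ) + α + 1) / (n.factorial : ℝ) * ((-1) ^ k * (n.choose k : ℝ))),
    tricomiPsi,
    Real.Gamma_nat_eq_factorial, ← mul_assoc, mul_one_div, ← integral_const_mul]
  refine setIntegral_congr_fun measurableSet_Ioi fun t ht => ?_
  have ht : 0 < t := ht
  have h1t : 0 < 1 + t := by positivity
  -- The binomial theorem for `(1 - 1/(1+t))^n`; the factor `t^n` created here raises the first
  -- Tricomi parameter from `1` to `n + 1`.
  have hsplit : t ^ n * ((1 + t) ^ n)⁻¹ =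
      ∑ k ∈ Finset.range (n + 1), (-1) ^ k * (n.choose k : ℝ) * ((1 + t) ^ k)⁻¹ := by
    have := add_pow (-(1 + t)⁻¹) 1 n
    rw [show -(1 + t)⁻¹ + 1 = t * (1 + t)⁻¹ by field_simp; ring, mul_pow, inv_pow] at this
    rw [this]
    refine Finset.sum_congr rfl fun k _ => ?_
    rw [one_pow, neg_pow, inv_pow]
    ring
  have hpow : ∀ k : ℕ, (1 + t) ^ (1 - (α + k) - 1 - 1) = (1 + t) ^ (-α - 1) * ((1 + t) ^ k)⁻¹ := by
    intro k
    rw [← Real.rpow_natCast, ← Real.rpow_neg h1t.le, ← Real.rpow_add h1t]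
    ring_nf
  have hpow' : (1 + t) ^ (1 - α - ((n : ℝ) + 1) - 1) = (1 + t) ^ (-α - 1) * ((1 + t) ^ n)⁻¹ := by
    rw [← hpow n]
    ring_nf
  simp only [hpow, hpow', sub_self, Real.rpow_zero, add_sub_cancel_right, Real.rpow_natCast]
  calc _ = Real.Gamma ((n : ℝ) + α + 1) / (n.factorial : ℝ) * Real.exp (-x * t) *
        (1 + t) ^ (-α - 1) *
        ∑ k ∈ Finset.range (n + 1), (-1) ^ k * (n.choose k : ℝ) * ((1 + t) ^ k)⁻¹ := by
        rw [Finset.mul_sum]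
        refine Finset.sum_congr rfl fun k _ => ?_
        ring
    _ = _ := by
        rw [← hsplit]
        ring

theorem theorem4p3 (α : ℝ) (hα : -1 < α) (hα' : ∀ k : ℕ, α ≠ (k : ℝ)) (n : ℕ)
    (ξ : ℝ) (hξ : ξ < 0) :
    IntegrableOn (fun η : ℝ => η ^ α * Real.exp (-η) * laguerreL n α η / (η - ξ)) (Ioi 0) ∧
    (∫ η in Ioi (0 : ℝ), η ^ α * Real.exp (-η) * laguerreL n α η / (η - ξ)) =
      Real.Gamma α * kummerPhi ((n : ℝ) + 1) (1 - α) (-ξ) +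
        Real.Gamma (-α) * Real.Gamma ((n : ℝ) + α + 1) / (n.factorial : ℝ) *
          (-ξ) ^ α * kummerPhi ((n : ℝ) + 1 + α) (1 + α) (-ξ) ∧
    (∫ η in Ioi (0 : ℝ), η ^ α * Real.exp (-η) * laguerreL n α η / (η - ξ)) =
      Real.Gamma ((n : ℝ) + α + 1) * tricomiPsi ((n : ℝ) + 1) (1 - α) (-ξ) := by
  have hx : 0 < -ξ := neg_pos.2 hξ
  have h := integral_laguerre_div_add n hα hx
  have h' := integrableOn_laguerre_div_add n hα hx
  simp only [← sub_eq_add_neg] at h h'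
  exact ⟨h', h.trans (tricomiPsi_eq_kummerSide n hα hα' hx), h⟩
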